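/- Let $L$ be the Fraïssé limit of the class of all finite nontrivial Heyting algebras, i.e. the (unique up to isomorphism) countable ultrahomogeneous structure in the language $\{0,1,\wedge,\vee,\to\}$ whose finitely generated substructures are, up to isomorphism, exactly the finite nontrivial Heyting algebras. Equip the automorphism group of a countable structure with the topology of pointwise convergence (the structure being discrete); it is then a non-archimedean topological group. A non-archimedean topological group $G$ is called Roelcke precompact if for every open subgroup $V \le G$ the set of double cosets $\{VxV \mid x \in G\}$ is finite. Then $\mathrm{Aut}(L)$ is not Roelcke precompact. Consequently, $\mathrm{Aut}(L)$ is not isomorphic, as a topological group, to the automorphism group $\mathrm{Aut}(M)$ of any countable $\omega$-categorical structure $M$, i.e. of any countable structure $M$ in a countable language such that any two countably infinite models of the complete theory of $M$ are isomorphic. -/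

import Mathlib

universe u v w w'

namespace HeytingAut

open scoped FirstOrder

section AutomorphismGroup

variable (L : FirstOrder.Language.{u, v}) (M : Type w) [L.Structure M]

/-- The automorphism group `Aut(M)` of a first-order structure `M`. -/
abbrev Aut : Type w := M ≃[L] M

variable {L M}

/-- Composition of automorphisms makes `Aut(M)` a group. -/
instance : Group (Aut L M) where
  mul g h := g.comp h
  one := FirstOrder.Language.Equiv.refl L M
  inv g := g.symm
  mul_assoc _ _ _ := rfl
  one_mul _ := rfl
  mul_one _ := rfl
  inv_mul_cancel g := FirstOrder.Language.Equiv.ext fun x => g.symm_apply_apply x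

@[simp] theorem Aut.mul_apply (g h : Aut L M) (x : M) : (g * h) x = g (h x) := rfl

@[simp] theorem Aut.one_apply (x : M) : (1 : Aut L M) x = x := rfl

@[simp] theorem Aut.apply_inv_self (g : Aut L M) (x : M) : g (g⁻¹ x) = x :=
  g.apply_symm_apply x

@[simp] theorem Aut.inv_apply_self (g : Aut L M) (x : M) : g⁻¹ (g x) = x :=
  g.symm_apply_apply x

/-- The topology of pointwise convergence on `Aut(M)`, where `M` is discrete: the subspace
topology inherited from the product `M → M` of discrete spaces. -/
instance : TopologicalSpace (Aut L M) :=
  TopologicalSpace.induced (fun g : Aut L M => (g : M → M))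
    (@Pi.topologicalSpace M (fun _ => M) (fun _ => ⊥))

/-- The pointwise stabilizer of a set of elements. -/
def Aut.fixing (S : Set M) : Subgroup (Aut L M) where
  carrier := {g | ∀ x ∈ S, g x = x}
  mul_mem' := fun {g h} hg hh x hx => by rw [Aut.mul_apply, hh x hx, hg x hx]
  one_mem' := fun _ _ => rfl
  inv_mem' := fun {g} hg x hx => by
    conv_lhs => rw [← hg x hx]
    exact Aut.inv_apply_self g x

/-- Basic neighbourhoods of `g` prescribe the values of `g` on a finite set. -/
theorem Aut.mem_nhds_iff (g : Aut L M) (U : Set (Aut L M)) :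
    U ∈ nhds g ↔ ∃ S : Set M, S.Finite ∧ ∀ h : Aut L M, (∀ x ∈ S, h x = g x) → h ∈ U := by
  let _ : TopologicalSpace M := ⊥
  have : DiscreteTopology M := ⟨rfl⟩
  rw [nhds_induced, Filter.mem_comap]
  constructor
  · rintro ⟨t, ht, htU⟩
    rw [nhds_pi, Filter.mem_pi] at ht
    obtain ⟨I, hI, s, hs, hst⟩ := ht
    refine ⟨I, hI, fun h hh => htU (hst fun x hx => ?_)⟩
    change h x ∈ s x
    rw [hh x hx]
    exact mem_of_mem_nhds (hs x)
  · rintro ⟨S, hS, hU⟩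
    refine ⟨S.pi fun x => {g x}, ?_, fun h hh => hU h fun x hx => hh x hx⟩
    exact set_pi_mem_nhds hS fun x _ => by simp

/-- `Aut(M)` is a non-archimedean topological group. -/
instance : NonarchimedeanGroup (Aut L M) where
  continuous_mul := by
    rw [continuous_iff_continuousAt]
    rintro ⟨g, h⟩ U hU
    obtain ⟨S, hS, hSU⟩ := (Aut.mem_nhds_iff _ _).1 hU
    rw [Filter.mem_map, nhds_prod_eq, Filter.mem_prod_iff]
    refine ⟨{g' | ∀ y ∈ h '' S, g' y = g y},
      (Aut.mem_nhds_iff _ _).2 ⟨h '' S, hS.image _, fun _ hk => hk⟩,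
      {h' | ∀ x ∈ S, h' x = h x},
      (Aut.mem_nhds_iff _ _).2 ⟨S, hS, fun _ hk => hk⟩, ?_⟩
    rintro ⟨g', h'⟩ ⟨hg, hh⟩
    refine hSU _ fun x hx => ?_
    simp only [Aut.mul_apply]
    rw [hh x hx]
    exact hg _ ⟨x, hx, rfl⟩
  continuous_inv := by
    rw [continuous_iff_continuousAt]
    intro g U hU
    obtain ⟨S, hS, hSU⟩ := (Aut.mem_nhds_iff _ _).1 hU
    rw [Filter.mem_map]
    refine (Aut.mem_nhds_iff _ _).2 ⟨(g⁻¹ : Aut L M) '' S, hS.image _, fun h hh => ?_⟩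
    refine hSU _ fun x hx => ?_
    have h1 := hh _ ⟨x, hx, rfl⟩
    rw [Aut.apply_inv_self] at h1
    calc h⁻¹ x = h⁻¹ (h (g⁻¹ x)) := by rw [h1]
      _ = g⁻¹ x := Aut.inv_apply_self h _
  is_nonarchimedean := by
    intro U hU
    obtain ⟨S, hS, hSU⟩ := (Aut.mem_nhds_iff _ _).1 hU
    refine ⟨⟨Aut.fixing S, ?_⟩, fun g hg => hSU g hg⟩
    refine isOpen_iff_mem_nhds.2 fun g hg => ?_
    exact (Aut.mem_nhds_iff _ _).2 ⟨S, hS, fun h hh x hx => (hh x hx).trans (hg x hx)⟩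

end AutomorphismGroup

/-- A non-archimedean topological group `G` is Roelcke precompact if for every open subgroup
`V ≤ G` the set of double cosets `{V x V | x ∈ G}` is finite. -/
def IsRoelckePrecompact (G : Type w) [Group G] [TopologicalSpace G] [NonarchimedeanGroup G] :
    Prop :=
  ∀ V : Subgroup G, IsOpen (V : Set G) →
    (Set.range fun x : G => DoubleCoset.doubleCoset x (V : Set G) (V : Set G)).Finite

/-- A countable structure `M` is `ω`-categorical if its language is countable and any two countably
infinite models of its complete theory are isomorphic. -/
structure IsCountableOmegaCategorical (L : FirstOrder.Language.{u, v}) (M : Type w) [L.Structure M] :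
    Prop where
  countable_language : Countable L.Symbols
  countable : Countable M
  categorical : Cardinal.Categorical Cardinal.aleph0.{w} (L.completeTheory M)

/-- The function symbols `0, 1, ∧, ∨, →` of the language of Heyting algebras. -/
inductive HeytingFunc : ℕ → Type
  | bot : HeytingFunc 0
  | top : HeytingFunc 0
  | inf : HeytingFunc 2
  | sup : HeytingFunc 2
  | imp : HeytingFunc 2

/-- The language `{0, 1, ∧, ∨, →}` of Heyting algebras. -/
def heytingLanguage : FirstOrder.Language.{0, 0} := ⟨HeytingFunc, fun _ => Empty⟩

instance : Countable (Σ l, heytingLanguage.Functions l) := by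
  have h : Function.Surjective (fun i : Fin 5 =>
      (![⟨0, .bot⟩, ⟨0, .top⟩, ⟨2, .inf⟩, ⟨2, .sup⟩, ⟨2, .imp⟩] i : Σ l, HeytingFunc l)) := by
    rintro ⟨_, _ | _ | _ | _ | _⟩
    exacts [⟨0, rfl⟩, ⟨1, rfl⟩, ⟨2, rfl⟩, ⟨3, rfl⟩, ⟨4, rfl⟩]
  exact h.countable

/-- A Heyting algebra as a first-order structure. -/
@[reducible] def heytingStructure (H : Type w) [HeytingAlgebra H] :
    heytingLanguage.Structure H where
  funMap {_} f :=
    match f with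
    | .bot => fun _ => ⊥
    | .top => fun _ => ⊤
    | .inf => fun x => x 0 ⊓ x 1
    | .sup => fun x => x 0 ⊔ x 1
    | .imp => fun x => x 0 ⇨ x 1
  RelMap {_} r := r.elim

/-- The class of finite nontrivial Heyting algebras. -/
def finiteHeytingAlgebras : Set (CategoryTheory.Bundled.{w} heytingLanguage.Structure) :=
  {A | Finite A ∧ Nontrivial A ∧ ∃ _ : HeytingAlgebra A, A.str = heytingStructure A}

end HeytingAut

/-! For `V` the stabilizer of a point `c`, the double coset of `g⁻¹ * g'` determines the orbit of
the pair `(g c, g' c)`. So it suffices to find infinitely many orbits of pairs whose entries all lie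
in the orbit of `c`.

In a finite Heyting algebra, a dense element other than `⊥` and `⊤` generates a three-element chain.
By ultrahomogeneity the images in the limit of all such elements form one orbit, and `c` is taken
there. Pairs of them can still generate arbitrarily large algebras, as in the Rieger–Nishimura
lattice. In the lower sets of a ladder with top index `N`, the terms `ladderTerm` applied to the
rungs 0 and 1 climb one rung at a time (`ladderTerm_rung`) and give `⊤` exactly from rung `N + 2`
on. Hence `N` is an invariant of the orbit of the pair (`ladder_length_eq`).

The consequence rests on Ryll-Nardzewski: an infinite `ω`-categorical `M` is atomic with finitely
many types of tuples of each finite length (`exists_finset_isIsolating`), tuples of equal type are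
conjugate (`SameType.exists_aut`), and the double coset of `x` depends only on the type of `(s, x
s)` for a finite tuple `s`. Roelcke precompactness passes through topological isomorphisms. -/

namespace HeytingAut

open scoped FirstOrder
open FirstOrder FirstOrder.Language Cardinal

/-! ### Realizing and isolating types in an `ω`-categorical structure. -/

section Categorical

universe x y

variable {L : FirstOrder.Language.{u, v}} {M : Type w} [L.Structure M] {α : Type x} {β : Type y}

/-- Compactness and Löwenheim–Skolem realize `Γ` in some countably infinite model, which
categoricity identifies with `M`. Countability of `α` keeps the language with new constants
countable. -/
theorem IsCountableOmegaCategorical.exists_realize (h : IsCountableOmegaCategorical L M)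
    [Infinite M] [Countable α] (Γ : Set (L.Formula α))
    (hΓ : ∀ Δ : Finset (L.Formula α), (Δ : Set (L.Formula α)) ⊆ Γ →
      ∃ v : α → M, ∀ φ ∈ Δ, φ.Realize v) :
    ∃ v : α → M, ∀ φ ∈ Γ, φ.Realize v := by
  classical
  have := h.countable
  have := h.countable_language
  let T : L[[α]].Theory :=
    (L.lhomWithConstants α).onTheory (L.completeTheory M) ∪ Formula.equivSentence '' Γ
  have hT : T.IsSatisfiable := by
    rw [Theory.isSatisfiable_iff_isFinitelySatisfiable]
    intro T₀ hT₀
    obtain ⟨v, hv⟩ := hΓ ((T₀.image Formula.equivSentence.symm).filter (· ∈ Γ))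
      fun φ hφ => (Finset.mem_filter.1 hφ).2
    let : (constantsOn α).Structure M := constantsOn.structure v
    have hM : M ⊨ (T₀ : L[[α]].Theory) := by
      refine ⟨fun φ hφ => ?_⟩
      rcases hT₀ hφ with h₁ | ⟨ψ, hψ, rfl⟩
      · exact ((LHom.onTheory_model (L.lhomWithConstants α) (L.completeTheory M)).2
          inferInstance).realize_of_mem φ h₁
      · refine (Formula.realize_equivSentence M ψ).2 (hv ψ ?_)
        exact Finset.mem_filter.2 ⟨Finset.mem_image.2 ⟨_, hφ, by simp⟩, hψ⟩
    exact Theory.Model.isSatisfiable M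
  have hInf : ∃ N : T.ModelType, Infinite N := by
    obtain ⟨N⟩ := hT
    let N' : (L.completeTheory M).ModelType :=
      (N.subtheoryModel Set.subset_union_left).reduct (L.lhomWithConstants α)
    exact ⟨N, (model_infiniteTheory_iff L (M := N')).1
      (N'.is_model.mono (Theory.completeTheory.subset (M := M)))⟩
  have hcard : L.card ≤ ℵ₀ := mk_le_aleph0
  obtain ⟨N, hN⟩ := Theory.exists_model_card_eq hInf ℵ₀ le_rfl (by simpa using hcard)
  let N' : (L.completeTheory M).ModelType :=
    (N.subtheoryModel Set.subset_union_left).reduct (L.lhomWithConstants α)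
  obtain ⟨e⟩ := h.categorical N' (Theory.ModelType.of (L.completeTheory M) M) hN
    (mk_eq_aleph0 M)
  let : L.Structure N := (L.lhomWithConstants α).reduct N
  have : (L.lhomWithConstants α).IsExpansionOn N := LHom.isExpansionOn_reduct _ _
  refine ⟨fun a => e (L.con a : N), fun φ hφ => ?_⟩
  have h₁ : (Formula.equivSentence φ).Realize N :=
    N.is_model.realize_of_mem _ (Or.inr ⟨φ, hφ, rfl⟩)
  exact (StrongHomClass.realize_formula e φ).2 ((Formula.realize_equivSentence N φ).1 h₁)

/-- Two tuples satisfy the same formulas. -/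
def SameType (L : FirstOrder.Language.{u, v}) {M : Type w} [L.Structure M] {α : Type x}
    (v w : α → M) : Prop :=
  ∀ φ : L.Formula α, φ.Realize v ↔ φ.Realize w

/-- A formula which isolates a complete type, up to equivalence in `M`. -/
def IsIsolating (M : Type w) [L.Structure M] (θ : L.Formula α) : Prop :=
  ∀ v w : α → M, θ.Realize v → θ.Realize w → SameType L v w

/-- The complete type of the tuple is isolated. -/
def IsAtomic (L : FirstOrder.Language.{u, v}) {M : Type w} [L.Structure M] {α : Type x}
    (v : α → M) : Prop :=
  ∃ θ : L.Formula α, θ.Realize v ∧ IsIsolating M θ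

theorem SameType.symm {v w : α → M} (h : SameType L v w) : SameType L w v :=
  fun φ => (h φ).symm

theorem SameType.comp {v w : α → M} (h : SameType L v w) (f : β → α) :
    SameType L (v ∘ f) (w ∘ f) := fun φ => by
  simpa only [Formula.realize_relabel] using h (φ.relabel f)

theorem IsAtomic.comp [Finite α] [Finite β] {v : α → M} (h : IsAtomic L v) (f : β → α) :
    IsAtomic L (v ∘ f) := by
  obtain ⟨θ, hv, hθ⟩ := h
  refine ⟨(θ.relabel Sum.inr ⊓ Formula.iInf fun b : β =>
    Term.equal (Term.var (Sum.inl b)) (Term.var (Sum.inr (f b))) : L.Formula (β ⊕ α)).iExs α,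
    ?_, ?_⟩
  · rw [Formula.realize_iExs]
    refine ⟨v, ?_⟩
    simpa [Formula.realize_inf, Formula.realize_relabel, Formula.realize_iInf,
      Formula.realize_equal, Function.comp_def] using hv
  · intro p q hp hq
    rw [Formula.realize_iExs] at hp hq
    obtain ⟨p', hp⟩ := hp
    obtain ⟨q', hq⟩ := hq
    simp only [Formula.realize_inf, Formula.realize_relabel, Formula.realize_iInf,
      Formula.realize_equal, Term.realize_var, Sum.elim_inl, Sum.elim_inr,
      Sum.elim_comp_inr] at hp hq
    obtain rfl : p = p' ∘ f := funext hp.2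
    obtain rfl : q = q' ∘ f := funext hq.2
    exact (hθ _ _ hp.1 hq.1).comp f

/-- Existential quantification over the distinguished variable. -/
theorem SameType.exists_option {v w : α → M} (h : SameType L v w) (φ : L.Formula (Option α))
    {a : M} (ha : φ.Realize fun o => o.elim a v) : ∃ b, φ.Realize fun o => o.elim b w := by
  let ψ : L.Formula α := (φ.relabel fun o => o.elim (Sum.inr ()) Sum.inl).iExs Unit
  have key (z : α → M) : ψ.Realize z ↔ ∃ b, φ.Realize fun o => o.elim b z := by
    have (i : Unit → M) : (Sum.elim z i ∘ fun o : Option α => o.elim (Sum.inr ()) Sum.inl) =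
        fun o => o.elim (i ()) z := by
      funext o; cases o <;> rfl
    simp only [ψ, Formula.realize_iExs, Formula.realize_relabel, this]
    exact ⟨fun ⟨i, hi⟩ => ⟨_, hi⟩, fun ⟨b, hb⟩ => ⟨fun _ => b, hb⟩⟩
  exact (key w).1 ((h ψ).1 ((key v).2 ⟨a, ha⟩))

/-- Otherwise every consistent formula below `φ` can be strengthened so as to exclude any given
tuple. Excluding the countably many tuples of `M` in turn yields a finitely satisfiable set of
formulas that no tuple realizes, against `exists_realize`. -/
theorem IsCountableOmegaCategorical.exists_isIsolating (h : IsCountableOmegaCategorical L M)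
    [Infinite M] [Finite α] (φ : L.Formula α) (hφ : ∃ v : α → M, φ.Realize v) :
    ∃ θ : L.Formula α, (∃ v : α → M, θ.Realize v) ∧ (∀ v : α → M, θ.Realize v → φ.Realize v) ∧
      IsIsolating M θ := by
  by_contra! hne
  have := h.countable
  let P := {ψ : L.Formula α // (∃ v : α → M, ψ.Realize v) ∧
    ∀ v : α → M, ψ.Realize v → φ.Realize v}
  have step (ψ : P) (t : α → M) : ∃ χ : P, (∀ v : α → M, χ.1.Realize v → ψ.1.Realize v) ∧
      ¬ χ.1.Realize t := by
    have h₁ := hne ψ.1 ψ.2.1 ψ.2.2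
    simp only [IsIsolating, SameType, not_forall] at h₁
    obtain ⟨v, w, hv, hw, χ, hχ⟩ := h₁
    -- Both `χ` and its negation are consistent with `ψ`; the one that fails at `t` is kept.
    have h₂ : ∃ χ : L.Formula α, (∃ v : α → M, (ψ.1 ⊓ χ).Realize v) ∧ ¬ χ.Realize t := by
      by_cases ht : χ.Realize t
      · refine ⟨∼χ, ?_, by simpa [Formula.realize_not] using ht⟩
        simp only [Formula.realize_inf, Formula.realize_not]
        by_cases h₃ : χ.Realize v
        · exact ⟨w, hw, fun h₄ => hχ (iff_of_true h₃ h₄)⟩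
        · exact ⟨v, hv, h₃⟩
      · refine ⟨χ, ?_, ht⟩
        simp only [Formula.realize_inf]
        by_cases h₃ : χ.Realize v
        · exact ⟨v, hv, h₃⟩
        · exact ⟨w, hw, by_contra fun h₄ => hχ (iff_of_false h₃ h₄)⟩
    obtain ⟨χ, hχ, ht⟩ := h₂
    refine ⟨⟨ψ.1 ⊓ χ, hχ, fun v hv => ψ.2.2 v (Formula.realize_inf.1 hv).1⟩,
      fun v hv => (Formula.realize_inf.1 hv).1, fun ht' => ht (Formula.realize_inf.1 ht').2⟩
  choose next hnext hnext' using step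
  obtain ⟨t, ht⟩ := exists_surjective_nat (α → M)
  let s : ℕ → P := fun n => Nat.rec ⟨φ, hφ, fun _ => id⟩ (fun k ψ => next ψ (t k)) n
  have hs (n : ℕ) : s (n + 1) = next (s n) (t n) := rfl
  have hmono (m n : ℕ) (hmn : m ≤ n) (v : α → M) (hv : (s n).1.Realize v) :
      (s m).1.Realize v := by
    induction n, hmn using Nat.le_induction with
    | base => exact hv
    | succ n _ ih => exact ih (hnext _ _ _ (hs n ▸ hv))
  obtain ⟨v, hv⟩ := h.exists_realize (Set.range fun n => (s n).1) (by
    intro Δ hΔ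
    have : ∃ N, ∀ ψ ∈ Δ, ∃ n ≤ N, (s n).1 = ψ := by
      choose! f hf using fun ψ (hψ : ψ ∈ Δ) => hΔ hψ
      exact ⟨Δ.sup f, fun ψ hψ => ⟨f ψ, Finset.le_sup hψ, hf ψ hψ⟩⟩
    obtain ⟨N, hN⟩ := this
    obtain ⟨v, hv⟩ := (s N).2.1
    refine ⟨v, fun ψ hψ => ?_⟩
    obtain ⟨n, hn, rfl⟩ := hN ψ hψ
    exact hmono _ _ hn v hv)
  obtain ⟨n, rfl⟩ := ht v
  exact hnext' (s n) (t n) (hs n ▸ hv _ ⟨n + 1, rfl⟩)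

end Categorical

/-! ### Atomicity of infinite countable `ω`-categorical structures. -/

section AtomicModel

universe x y

variable {L : FirstOrder.Language.{u, v}} {M : Type w} [L.Structure M] {α : Type x} {β : Type y}

/-- The formula with variables `Fin (n + 1)` corresponding to a bounded formula. -/
def lastVarFormula {n : ℕ} (φ : L.BoundedFormula Empty (n + 1)) : L.Formula (Fin (n + 1)) :=
  φ.toFormula.relabel (Sum.elim Empty.elim id)

theorem realize_lastVarFormula {n : ℕ} (φ : L.BoundedFormula Empty (n + 1))
    (x : Fin (n + 1) → M) : (lastVarFormula φ).Realize x ↔ φ.Realize default x := by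
  rw [lastVarFormula, Formula.realize_relabel, BoundedFormula.realize_toFormula]
  exact iff_of_eq (congrArg₂ _ (Subsingleton.elim _ _) rfl)

/-- The formula `f x₀ … xₙ₋₁ = xₙ`. -/
def graphFormula {n : ℕ} (f : L.Functions n) : L.Formula (Fin (n + 1)) :=
  Term.equal (Term.func f fun i => Term.var i.castSucc) (Term.var (Fin.last n))

theorem realize_graphFormula {n : ℕ} (f : L.Functions n) (x : Fin (n + 1) → M) :
    (graphFormula f).Realize x ↔ Structure.funMap f (fun i => x i.castSucc) = x (Fin.last n) := by
  simp [graphFormula, Formula.realize_equal]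

theorem IsCountableOmegaCategorical.exists_isAtomic_option (h : IsCountableOmegaCategorical L M)
    [Infinite M] [Finite α] {v : α → M} (hv : IsAtomic L v) (φ : L.Formula (Option α))
    {a : M} (ha : φ.Realize fun o => o.elim a v) :
    ∃ b, φ.Realize (fun o => o.elim b v) ∧ IsAtomic L fun o : Option α => o.elim b v := by
  obtain ⟨θ, hθv, hθ⟩ := hv
  obtain ⟨χ, ⟨w, hw⟩, hχ, hχ'⟩ := h.exists_isIsolating (θ.relabel some ⊓ φ)
    ⟨fun o => o.elim a v, Formula.realize_inf.2 ⟨Formula.realize_relabel.2 hθv, ha⟩⟩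
  have hw' := Formula.realize_inf.1 (hχ w hw)
  have h₁ : SameType L (w ∘ some) v := hθ _ _ (Formula.realize_relabel.1 hw'.1) hθv
  have hw₂ : w = fun o => o.elim (w none) (w ∘ some) := by funext o; cases o <;> rfl
  rw [hw₂] at hw
  obtain ⟨b, hb⟩ := h₁.exists_option χ hw
  exact ⟨b, (Formula.realize_inf.1 (hχ _ hb)).2, χ, hb, hχ'⟩

/-- A generic ideal of finite atomic sets meets a cofinal family for each formula with parameters.
Its union then passes the Tarski–Vaught test. -/
theorem IsCountableOmegaCategorical.exists_atomic_elementarySubstructure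
    (h : IsCountableOmegaCategorical L M) [Infinite M] :
    ∃ S : L.ElementarySubstructure M, ∀ s : Finset S, IsAtomic L fun x : s => (x.1 : M) := by
  classical
  have := h.countable
  have := h.countable_language
  let P := {s : Finset M // IsAtomic L fun x : s => (x : M)}
  let ι := Σ n, L.Formula (Fin (n + 1)) × (Fin n → M)
  have : Countable ι := inferInstance
  let Good (i : ι) (b : M) : Prop := i.2.1.Realize (Fin.snoc i.2.2 b : Fin (i.1 + 1) → M)
  -- The third alternative secures cofinality when the parameters cannot be adjoined to `s`
  -- atomically. It never occurs for parameters in the union of the ideal, by directedness.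
  let D (i : ι) : Order.Cofinal P :=
    { carrier := {s | (∃ b ∈ s.1, Good i b) ∨ (¬ ∃ b, Good i b) ∨
        ∀ t : P, s ≤ t → ¬ ∀ k, i.2.2 k ∈ t.1}
      isCofinal := fun s => by
        by_cases hs : (∃ b, Good i b) ∧ ∃ t : P, s ≤ t ∧ ∀ k, i.2.2 k ∈ t.1
        · obtain ⟨⟨a, ha⟩, t, hst, ht⟩ := hs
          obtain ⟨n, φ, x⟩ := i
          let f : Fin (n + 1) → Option t.1 := Fin.snoc (fun k => some ⟨x k, ht k⟩) none
          have hf (b : M) : (fun o : Option t.1 => o.elim b fun y => (y : M)) ∘ f =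
              (Fin.snoc x b : Fin (n + 1) → M) := by
            funext k
            refine Fin.lastCases ?_ (fun k => ?_) k <;> simp [f]
          obtain ⟨b, hb, hb'⟩ := h.exists_isAtomic_option t.2 (φ.relabel f) (a := a) (by
            rw [Formula.realize_relabel, hf]; exact ha)
          rw [Formula.realize_relabel, hf] at hb
          have h₂ : ∀ y : ↥(insert b t.1), ∃ o : Option t.1,
              (o.elim b fun y => (y : M)) = y := by
            rintro ⟨y, hy⟩
            rcases Finset.mem_insert.1 hy with rfl | hy
            · exact ⟨none, rfl⟩
            · exact ⟨some ⟨y, hy⟩, rfl⟩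
          choose g hg using h₂
          have h₃ := hb'.comp g
          rw [show (fun o : Option t.1 => o.elim b fun y => (y : M)) ∘ g =
              fun y : ↥(insert b t.1) => (y : M) from funext hg] at h₃
          exact ⟨⟨insert b t.1, h₃⟩, Or.inl ⟨b, Finset.mem_insert_self _ _, hb⟩,
            hst.trans (Finset.subset_insert b t.1)⟩
        · refine ⟨s, ?_, le_rfl⟩
          rw [not_and_or] at hs
          refine Or.inr (hs.imp id fun hs t hst ht => hs ⟨t, hst, ht⟩) }
  have hempty : IsAtomic L fun x : (∅ : Finset M) => (x : M) :=
    ⟨⊤, Formula.realize_top.2 trivial, fun v w _ _ => by rw [Subsingleton.elim v w]; exact fun _ => Iff.rfl⟩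
  let : Encodable ι := Encodable.ofCountable ι
  let I := Order.idealOfCofinals ⟨∅, hempty⟩ D
  let A : Set M := {a | ∃ s ∈ I, a ∈ s.1}
  have hA (s : Finset M) (hs : ∀ a ∈ s, a ∈ A) : ∃ t ∈ I, s ⊆ t.1 := by
    induction s using Finset.induction_on with
    | empty => exact ⟨_, Order.mem_idealOfCofinals _ _, Finset.empty_subset _⟩
    | insert a s _ ih =>
      obtain ⟨t, ht, hst⟩ := ih fun b hb => hs b (Finset.mem_insert_of_mem hb)
      obtain ⟨t', ht', hat⟩ := hs a (Finset.mem_insert_self _ _)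
      obtain ⟨t'', ht'', h₁, h₂⟩ := I.directed t ht t' ht'
      exact ⟨t'', ht'', Finset.insert_subset (h₂ hat) (hst.trans h₁)⟩
  have hwit {n : ℕ} (φ : L.Formula (Fin (n + 1))) (x : Fin n → M) (hx : ∀ k, x k ∈ A) (a : M)
      (ha : φ.Realize (Fin.snoc x a : Fin (n + 1) → M)) :
      ∃ b ∈ A, φ.Realize (Fin.snoc x b : Fin (n + 1) → M) := by
    obtain ⟨s, hs, hsI⟩ := Order.cofinal_meets_idealOfCofinals ⟨∅, hempty⟩ D ⟨n, φ, x⟩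
    rcases hs with ⟨b, hb, hb'⟩ | hs | hs
    · exact ⟨b, ⟨s, hsI, hb⟩, hb'⟩
    · exact absurd ⟨a, ha⟩ hs
    · obtain ⟨t, ht, hxt⟩ := hA (Finset.univ.image x) (by simpa using hx)
      obtain ⟨t', ht', h₁, h₂⟩ := I.directed s hsI t ht
      exact absurd (fun k => h₂ (hxt (Finset.mem_image_of_mem _ (Finset.mem_univ k)))) (hs t' h₁)
  let S : L.Substructure M :=
    { carrier := A
      fun_mem := fun {n} f x hx => by
        obtain ⟨b, hb, hb'⟩ := hwit (graphFormula f) x hx (Structure.funMap f x)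
          ((realize_graphFormula _ _).2 (by simp))
        rw [realize_graphFormula] at hb'
        simp only [Fin.snoc_castSucc, Fin.snoc_last] at hb'
        exact hb' ▸ hb }
  refine ⟨S.toElementarySubstructure fun n φ x a ha => ?_, fun s => ?_⟩
  · obtain ⟨b, hb, hb'⟩ := hwit (lastVarFormula φ) (fun k => (x k).1) (fun k => (x k).2) a
      ((realize_lastVarFormula _ _).2 ha)
    exact ⟨⟨b, hb⟩, (realize_lastVarFormula _ _).1 hb'⟩
  · obtain ⟨t, -, ht⟩ := hA (s.map (Function.Embedding.subtype _)) (by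
      intro a ha
      obtain ⟨b, -, rfl⟩ := Finset.mem_map.1 ha
      exact b.2)
    exact t.2.comp fun x : s =>
      (⟨x.1, ht (Finset.mem_map_of_mem (Function.Embedding.subtype _) x.2)⟩ : t.1)

/-- The atomic elementary substructure is itself a countably infinite model, hence isomorphic to
`M`. -/
theorem IsCountableOmegaCategorical.isAtomic (h : IsCountableOmegaCategorical L M) [Infinite M]
    [Finite α] (v : α → M) : IsAtomic L v := by
  classical
  have := h.countable
  obtain ⟨S, hS⟩ := h.exists_atomic_elementarySubstructure
  have : Infinite S := S.elementarilyEquivalent.symm.infinite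
  obtain ⟨e⟩ := h.categorical (S.toModel (M := Theory.ModelType.of (L.completeTheory M) M))
    (Theory.ModelType.of (L.completeTheory M) M) (mk_eq_aleph0 S) (mk_eq_aleph0 M)
  change S ≃[L] M at e
  have := Fintype.ofFinite α
  obtain ⟨θ, hv, hθ⟩ := (hS (Finset.univ.image (e.symm ∘ v))).comp fun a : α =>
    (⟨e.symm (v a), Finset.mem_image_of_mem _ (Finset.mem_univ a)⟩ :
      ↥(Finset.univ.image (e.symm ∘ v)))
  have key (z : α → M) (φ : L.Formula α) :
      φ.Realize (fun a => (e.symm (z a) : M)) ↔ φ.Realize z := by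
    rw [show (fun a => (e.symm (z a) : M)) = S.subtype ∘ (e.symm ∘ z) from rfl,
      S.subtype.map_formula, StrongHomClass.realize_formula]
  exact ⟨θ, (key v θ).1 hv, fun p q hp hq φ =>
    (key p φ).symm.trans ((hθ _ _ ((key p θ).2 hp) ((key q θ).2 hq) φ).trans (key q φ))⟩

end AtomicModel

/-! ### Back-and-forth, finitely many types, and Roelcke precompactness. -/

section Oligomorphic

universe x y

variable {L : FirstOrder.Language.{u, v}} {M : Type w} [L.Structure M] {α : Type x} {β : Type y}

/-- A relation between elements of `M`, total on both sides, which preserves all formulas is the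
graph of an automorphism. -/
theorem exists_aut_of_sameType (U : Set (M × M)) (hdom : ∀ a, ∃ b, (a, b) ∈ U)
    (hcod : ∀ b, ∃ a, (a, b) ∈ U)
    (hU : ∀ (n : ℕ) (x y : Fin n → M), (∀ k, (x k, y k) ∈ U) → SameType L x y) :
    ∃ g : Aut L M, ∀ p ∈ U, g p.1 = p.2 := by
  choose f hf using hdom
  have huniq {a b c d : M} (hab : (a, b) ∈ U) (hcd : (c, d) ∈ U) : a = c ↔ b = d := by
    have := hU 2 ![a, c] ![b, d] (by intro k; fin_cases k <;> assumption)
      (Term.equal (Term.var 0) (Term.var 1))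
    simpa [Formula.realize_equal] using this
  have hf' {a b : M} (h : (a, b) ∈ U) : f a = b := (huniq (hf a) h).1 rfl
  refine ⟨⟨Equiv.ofBijective f ⟨fun a c h => (huniq (hf a) (hf c)).2 h, fun b => ?_⟩, ?_, ?_⟩,
    fun p hp => hf' hp⟩
  · obtain ⟨a, ha⟩ := hcod b
    exact ⟨a, hf' ha⟩
  · intro n F x
    change f (Structure.funMap F x) = Structure.funMap F (f ∘ x)
    have := hU (n + 1) (Fin.snoc x (Structure.funMap F x))
      (Fin.snoc (f ∘ x) (f (Structure.funMap F x)))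
      (fun k => by refine Fin.lastCases ?_ (fun k => ?_) k <;> simp [hf]) (graphFormula F)
    simp only [realize_graphFormula, Fin.snoc_castSucc, Fin.snoc_last, true_iff] at this
    exact this.symm
  · intro n R x
    change Structure.RelMap R (f ∘ x) ↔ Structure.RelMap R x
    have := hU n x (f ∘ x) (fun k => hf _) (R.formula fun i => Term.var i)
    simpa [Formula.realize_rel, Function.comp_def] using this.symm

/-- Back-and-forth: a generic ideal of finite type-preserving relations, where atomicity supplies
each one-point extension. -/
theorem SameType.exists_aut [Countable M] [Finite α]
    (hM : ∀ (β : Type w) [Finite β] (z : β → M), IsAtomic L z) {v w : α → M}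
    (h : SameType L v w) : ∃ g : Aut L M, g ∘ v = w := by
  classical
  let Q (s : Finset (M × M)) : Prop :=
    SameType L (fun p : s => (p : M × M).1) (fun p : s => (p : M × M).2)
  have hext {β : Type w} [Finite β] {v w : β → M} (h : SameType L v w) (a : M) :
      ∃ b, SameType L (fun o : Option β => o.elim a v) (fun o : Option β => o.elim b w) := by
    obtain ⟨θ, hv, hθ⟩ := hM (Option β) fun o => o.elim a v
    obtain ⟨b, hb⟩ := h.exists_option θ hv
    exact ⟨b, hθ _ _ hv hb⟩
  have hins {s : Finset (M × M)} {a b : M}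
      (h : SameType L (fun o : Option s => o.elim a fun p => (p : M × M).1)
        (fun o : Option s => o.elim b fun p => (p : M × M).2)) : Q (insert (a, b) s) := by
    have h₂ : ∀ y : ↥(insert (a, b) s), ∃ o : Option s,
        (o.elim a fun p => (p : M × M).1) = y.1.1 ∧
          (o.elim b fun p => (p : M × M).2) = y.1.2 := by
      rintro ⟨y, hy⟩
      rcases Finset.mem_insert.1 hy with rfl | hy
      · exact ⟨none, rfl, rfl⟩
      · exact ⟨some ⟨y, hy⟩, rfl, rfl⟩
    choose g hg hg' using h₂
    have h₃ := h.comp g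
    rwa [show (fun o : Option s => o.elim a fun p => (p : M × M).1) ∘ g =
        fun y : ↥(insert (a, b) s) => (y : M × M).1 from funext hg,
      show (fun o : Option s => o.elim b fun p => (p : M × M).2) ∘ g =
        fun y : ↥(insert (a, b) s) => (y : M × M).2 from funext hg'] at h₃
  let P := {s : Finset (M × M) // Q s}
  let D (i : M ⊕ M) : Order.Cofinal P :=
    { carrier := {s | i.elim (fun a => ∃ b, (a, b) ∈ s.1) (fun b => ∃ a, (a, b) ∈ s.1)}
      isCofinal := fun s => by
        rcases i with a | b
        · obtain ⟨b, hb⟩ := hext s.2 a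
          exact ⟨⟨_, hins hb⟩, ⟨b, Finset.mem_insert_self _ _⟩, Finset.subset_insert _ s.1⟩
        · obtain ⟨a, ha⟩ := hext s.2.symm b
          exact ⟨⟨_, hins ha.symm⟩, ⟨a, Finset.mem_insert_self _ _⟩,
            Finset.subset_insert _ s.1⟩ }
  have := Fintype.ofFinite α
  have h₀ : Q (Finset.univ.image fun i => (v i, w i)) := by
    have h₂ : ∀ y : ↥(Finset.univ.image fun i => (v i, w i)), ∃ i, (v i, w i) = y.1 := by
      rintro ⟨y, hy⟩
      obtain ⟨i, -, hi⟩ := Finset.mem_image.1 hy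
      exact ⟨i, hi⟩
    choose g hg using h₂
    have h₃ := h.comp g
    rwa [show v ∘ g = fun y => y.1.1 from funext fun y => congrArg Prod.fst (hg y),
      show w ∘ g = fun y => y.1.2 from funext fun y => congrArg Prod.snd (hg y)] at h₃
  let : Encodable (M ⊕ M) := Encodable.ofCountable _
  let I := Order.idealOfCofinals (⟨_, h₀⟩ : P) D
  let U : Set (M × M) := {p | ∃ s ∈ I, p ∈ s.1}
  have hU (s : Finset (M × M)) (hs : ∀ a ∈ s, a ∈ U) : ∃ t ∈ I, s ⊆ t.1 := by
    induction s using Finset.induction_on with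
    | empty => exact ⟨_, Order.mem_idealOfCofinals _ _, Finset.empty_subset _⟩
    | insert a s _ ih =>
      obtain ⟨t, ht, hst⟩ := ih fun b hb => hs b (Finset.mem_insert_of_mem hb)
      obtain ⟨t', ht', hat⟩ := hs a (Finset.mem_insert_self _ _)
      obtain ⟨t'', ht'', h₁, h₂⟩ := I.directed t ht t' ht'
      exact ⟨t'', ht'', Finset.insert_subset (h₂ hat) (hst.trans h₁)⟩
  obtain ⟨g, hg⟩ := exists_aut_of_sameType (L := L) U
    (fun a => by
      obtain ⟨s, ⟨b, hb⟩, hsI⟩ := Order.cofinal_meets_idealOfCofinals (⟨_, h₀⟩ : P) D (Sum.inl a)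
      exact ⟨b, s, hsI, hb⟩)
    (fun b => by
      obtain ⟨s, ⟨a, ha⟩, hsI⟩ := Order.cofinal_meets_idealOfCofinals (⟨_, h₀⟩ : P) D (Sum.inr b)
      exact ⟨a, s, hsI, ha⟩)
    (fun n x y hxy => by
      obtain ⟨t, -, ht⟩ := hU (Finset.univ.image fun k => (x k, y k)) (by simpa using hxy)
      exact t.2.comp fun k =>
        (⟨(x k, y k), ht (Finset.mem_image_of_mem _ (Finset.mem_univ k))⟩ : t.1))
  exact ⟨g, funext fun i => hg (v i, w i) ⟨_, Order.mem_idealOfCofinals _ _,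
    Finset.mem_image_of_mem _ (Finset.mem_univ i)⟩⟩

/-- Half of the Ryll-Nardzewski theorem: finitely many formulas isolate all types of tuples. -/
theorem IsCountableOmegaCategorical.exists_finset_isIsolating
    (h : IsCountableOmegaCategorical L M) [Infinite M] [Finite α] :
    ∃ Δ : Finset (L.Formula α), (∀ θ ∈ Δ, IsIsolating M θ) ∧
      ∀ v : α → M, ∃ θ ∈ Δ, θ.Realize v := by
  classical
  by_contra! hne
  -- If no finite set of isolating formulas covers, compactness gives a tuple satisfying none of
  -- them, hence a non-atomic one.
  obtain ⟨v, hv⟩ := h.exists_realize (Formula.not '' {θ : L.Formula α | IsIsolating M θ})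
    fun Δ hΔ => by
      obtain ⟨Δ', hΔ', rfl⟩ := Finset.subset_set_image_iff.1 hΔ
      obtain ⟨v, hv⟩ := hne Δ' hΔ'
      refine ⟨v, fun φ hφ => ?_⟩
      obtain ⟨θ, hθ, rfl⟩ := Finset.mem_image.1 hφ
      exact Formula.realize_not.2 (hv θ hθ)
  obtain ⟨θ, hθv, hθ⟩ := h.isAtomic v
  exact Formula.realize_not.1 (hv _ ⟨θ, hθ, rfl⟩) hθv

theorem doubleCoset_eq_of_apply_eq {V : Subgroup (Aut L M)} {S : Set M}
    (hV : Aut.fixing S ≤ V) {x y g : Aut L M} (hg : ∀ a ∈ S, g a = a)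
    (hxy : ∀ a ∈ S, g (x a) = y a) :
    DoubleCoset.doubleCoset x (V : Set (Aut L M)) V = DoubleCoset.doubleCoset y V V := by
  refine (DoubleCoset.doubleCoset_eq_of_mem ((DoubleCoset.mem_doubleCoset).2
    ⟨g, hV hg, (g * x)⁻¹ * y, hV fun a ha => ?_, ?_⟩)).symm
  · rw [Aut.mul_apply, ← hxy a ha]
    exact Aut.inv_apply_self (g * x) a
  · group

theorem IsCountableOmegaCategorical.isRoelckePrecompact (h : IsCountableOmegaCategorical L M) :
    IsRoelckePrecompact (Aut L M) := by
  have := h.countable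
  intro V hV
  rcases finite_or_infinite M with hM | hM
  · have : Finite (Aut L M) := Finite.of_injective _ DFunLike.coe_injective
    exact Set.finite_range _
  · obtain ⟨S, hS, hSV⟩ := (Aut.mem_nhds_iff 1 _).1 (hV.mem_nhds V.one_mem)
    have : Finite S := hS
    obtain ⟨Δ, hΔ, hcov⟩ := h.exists_finset_isIsolating (α := S ⊕ S)
    choose c hcΔ hc using fun x : Aut L M =>
      hcov (Sum.elim (fun s => (s : M)) fun s => x (s : M))
    let d (x : Aut L M) : Δ := ⟨c x, hcΔ x⟩
    let f (x : Aut L M) := DoubleCoset.doubleCoset x (V : Set (Aut L M)) V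
    have hf : f.FactorsThrough d := fun x y hxy => by
      have hxy' : c x = c y := congrArg Subtype.val hxy
      obtain ⟨g, hg⟩ := SameType.exists_aut (fun β _ z => h.isAtomic z)
        (hΔ _ (hcΔ x) _ _ (hc x) (hxy' ▸ hc y))
      exact doubleCoset_eq_of_apply_eq (fun k hk => hSV k hk)
        (fun a ha => congrFun hg (Sum.inl ⟨a, ha⟩)) (fun a ha => congrFun hg (Sum.inr ⟨a, ha⟩))
    refine (Set.finite_range (Function.extend d f fun _ => ∅)).subset ?_
    rintro _ ⟨x, rfl⟩
    exact ⟨d x, hf.extend_apply _ x⟩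

end Oligomorphic

theorem IsRoelckePrecompact.of_continuousMulEquiv {G : Type w} {H : Type w'} [Group G]
    [TopologicalSpace G] [NonarchimedeanGroup G] [Group H] [TopologicalSpace H]
    [NonarchimedeanGroup H] (e : G ≃ₜ* H) (hH : IsRoelckePrecompact H) :
    IsRoelckePrecompact G := by
  intro V hV
  have hW : IsOpen ((V.comap e.symm.toMulEquiv.toMonoidHom : Subgroup H) : Set H) :=
    hV.preimage e.symm.continuous
  refine ((hH _ hW).image fun s => e ⁻¹' s).subset ?_
  rintro _ ⟨x, rfl⟩
  refine ⟨_, ⟨e x, rfl⟩, ?_⟩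
  ext y
  simp only [Set.mem_preimage, DoubleCoset.mem_doubleCoset]
  constructor
  · rintro ⟨a, ha, b, hb, hy⟩
    refine ⟨e.symm a, ha, e.symm b, hb, e.injective ?_⟩
    simp [hy]
  · rintro ⟨a, ha, b, hb, rfl⟩
    exact ⟨e a, (congrArg (· ∈ V) (e.symm_apply_apply a)).mpr ha, e b,
      (congrArg (· ∈ V) (e.symm_apply_apply b)).mpr hb, by simp⟩

/-! ### The ladder posets and their Heyting algebras of lower sets. -/

section Ladder

/-- The poset with points `0, …, N`, where `m ≤ n` iff `m = n` or `m + 2 ≤ n` for `m, n ≠ 0`,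
and `0` is the least element. -/
structure Ladder (N : ℕ) : Type w where
  idx : Fin (N + 1)

instance (N : ℕ) : Finite (Ladder.{w} N) :=
  Finite.of_injective Ladder.idx fun a b h => by cases a; cases b; congr

instance (N : ℕ) : PartialOrder (Ladder.{w} N) where
  le a b := a.idx = b.idx ∨ a.idx.1 + 2 ≤ b.idx.1 ∨ a.idx.1 = 0
  le_refl a := Or.inl rfl
  le_trans a b c := by simp only [Fin.ext_iff]; omega
  le_antisymm a b h h' := by
    obtain ⟨a⟩ := a
    obtain ⟨b⟩ := b
    simp only [Fin.ext_iff] at h h'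
    congr 1
    ext
    omega

theorem Ladder.le_def {N : ℕ} {a b : Ladder.{w} N} :
    a ≤ b ↔ a.idx.1 = b.idx.1 ∨ a.idx.1 + 2 ≤ b.idx.1 ∨ a.idx.1 = 0 := by
  rw [← Fin.ext_iff]; rfl

theorem mem_lowerSet_himp {P : Type*} [PartialOrder P] {s t : LowerSet P} {a : P} :
    a ∈ s ⇨ t ↔ ∀ b ≤ a, b ∈ s → b ∈ t := by
  rw [← LowerSet.Iic_le, le_himp_iff]
  exact ⟨fun h b hb hs => h ⟨hb, hs⟩, fun h b hb => h b hb.1 hb.2⟩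

/-- The principal ideals of the ladder, and beyond the top index first the ladder without its
last point and then the whole ladder. -/
def Ladder.rung (N k : ℕ) : LowerSet (Ladder.{w} N) where
  carrier := {a | a.idx.1 = k ∨ a.idx.1 + 2 ≤ k ∨ a.idx.1 = 0}
  lower' a b hba ha := by
    rw [Ladder.le_def] at hba
    simp only [Set.mem_ofPred_eq] at ha ⊢
    omega

theorem Ladder.mem_rung {N k : ℕ} {a : Ladder.{w} N} :
    a ∈ rung N k ↔ a.idx.1 = k ∨ a.idx.1 + 2 ≤ k ∨ a.idx.1 = 0 := Iff.rfl

/-- The implication consists of the points not above `m + 1`, namely `m + 2` and everything up to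
`m`. When `m + 1 > N` there is no such point and both sides are `⊤`. -/
theorem Ladder.mem_rung_himp {N k : ℕ} {s t : LowerSet (Ladder.{w} N)} {m : ℕ}
    (hs : ∀ b : Ladder.{w} N, b ∈ s ∧ b ∉ t ↔ b.idx.1 = m + 1) (hk : k = m + 2) :
    s ⇨ t = rung N k := by
  subst hk
  ext a
  change a ∈ s ⇨ t ↔ a ∈ rung N (m + 2)
  rw [mem_lowerSet_himp, Ladder.mem_rung]
  have ha := a.idx.2
  constructor
  · intro h
    by_contra hne
    have hm : m + 1 < N + 1 := by omega
    have h₁ := (hs ⟨⟨m + 1, hm⟩⟩).2 rfl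
    refine h₁.2 (h _ ?_ h₁.1)
    rw [Ladder.le_def]
    change m + 1 = _ ∨ m + 1 + 2 ≤ _ ∨ _
    omega
  · intro h b hb hbs
    by_contra hbt
    have := (hs b).1 ⟨hbs, hbt⟩
    rw [Ladder.le_def] at hb
    omega

/-- The points `N` and `N - 1` must both belong to the rung; `2 ≤ N` makes both differ from the
least point 0. -/
theorem Ladder.rung_eq_top_iff {N k : ℕ} (hN : 2 ≤ N) :
    rung.{w} N k = ⊤ ↔ N + 2 ≤ k := by
  constructor
  · intro h
    have key (j : ℕ) (hj : j < N + 1) : j = k ∨ j + 2 ≤ k ∨ j = 0 :=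
      Ladder.mem_rung.1 (h.symm ▸ LowerSet.mem_top :
        (⟨⟨j, hj⟩⟩ : Ladder.{w} N) ∈ rung N k)
    have := key N (by omega)
    have := key (N - 1) (by omega)
    omega
  · intro h
    refine eq_top_iff.2 fun a _ => ?_
    have ha := a.idx.2
    exact Ladder.mem_rung.2 (by omega)

theorem Ladder.rung_ne_bot (N k : ℕ) : rung.{w} N k ≠ ⊥ := fun h =>
  LowerSet.notMem_bot (h ▸ Ladder.mem_rung.2 (Or.inr (Or.inr rfl)) :
    (⟨⟨0, N.succ_pos⟩⟩ : Ladder.{w} N) ∈ (⊥ : LowerSet (Ladder.{w} N)))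

/-- The least point lies in every nonempty lower set, so all of these are dense. The ladder has a
least point for this purpose. -/
theorem Ladder.himp_bot_eq_bot {N : ℕ} {s : LowerSet (Ladder.{w} N)} (hs : s ≠ ⊥) : s ⇨ ⊥ = ⊥ := by
  have hz {t : LowerSet (Ladder.{w} N)} (ht : t ≠ ⊥) : (⟨⟨0, N.succ_pos⟩⟩ : Ladder.{w} N) ∈ t := by
    by_contra h
    refine ht (eq_bot_iff.2 fun a ha => (h (t.lower ?_ ha)).elim)
    exact Ladder.le_def.2 (Or.inr (Or.inr rfl))
  by_contra h
  exact LowerSet.notMem_bot (mem_lowerSet_himp.1 (hz h) _ le_rfl (hz hs))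

end Ladder

/-! ### Ladder terms, the three-element chain, and infinitely many double cosets. -/

section Structures

attribute [local instance] heytingStructure

/-- The interpretation of `→` in a structure in the language of Heyting algebras. -/
def structImp {A : Type w} [heytingLanguage.Structure A] (a b : A) : A :=
  Structure.funMap (L := heytingLanguage) (n := 2) HeytingFunc.imp ![a, b]

/-- The interpretation of `∨` in a structure in the language of Heyting algebras. -/
def structSup {A : Type w} [heytingLanguage.Structure A] (a b : A) : A :=
  Structure.funMap (L := heytingLanguage) (n := 2) HeytingFunc.sup ![a, b]

theorem map_structImp {A : Type w} {B : Type w'} [heytingLanguage.Structure A]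
    [heytingLanguage.Structure B] (f : A ↪[heytingLanguage] B) (a b : A) :
    f (structImp a b) = structImp (f a) (f b) :=
  (f.map_fun (n := 2) HeytingFunc.imp ![a, b]).trans
    (congrArg (Structure.funMap (L := heytingLanguage) (n := 2) HeytingFunc.imp)
      (show f ∘ ![a, b] = ![f a, f b] by funext i; fin_cases i <;> rfl))

theorem map_structSup {A : Type w} {B : Type w'} [heytingLanguage.Structure A]
    [heytingLanguage.Structure B] (f : A ↪[heytingLanguage] B) (a b : A) :
    f (structSup a b) = structSup (f a) (f b) :=
  (f.map_fun (n := 2) HeytingFunc.sup ![a, b]).trans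
    (congrArg (Structure.funMap (L := heytingLanguage) (n := 2) HeytingFunc.sup)
      (show f ∘ ![a, b] = ![f a, f b] by funext i; fin_cases i <;> rfl))

/-- A sequence of terms in two variables in the style of the Rieger–Nishimura lattice. -/
def ladderTerm {A : Type w} [heytingLanguage.Structure A] (a b : A) : ℕ → A
  | 0 => a
  | 1 => b
  | 2 => structImp b a
  | 3 => structImp (ladderTerm a b 2) a
  | k + 4 => structImp (ladderTerm a b (k + 3)) (structSup (ladderTerm a b (k + 1))
      (ladderTerm a b k))

theorem map_ladderTerm {A : Type w} {B : Type w'} [heytingLanguage.Structure A]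
    [heytingLanguage.Structure B] (f : A ↪[heytingLanguage] B) (a b : A) (k : ℕ) :
    f (ladderTerm a b k) = ladderTerm (f a) (f b) k := by
  induction k using Nat.strong_induction_on with
  | _ k ih =>
    match k with
    | 0 => rfl
    | 1 => rfl
    | 2 => exact map_structImp f b a
    | 3 => exact (map_structImp f _ a).trans (congrArg (structImp · (f a)) (ih 2 (by omega)))
    | k + 4 =>
      rw [ladderTerm, ladderTerm, map_structImp, map_structSup, ih (k + 3) (by omega),
        ih (k + 1) (by omega), ih k (by omega)]

theorem ladderTerm_rung (N k : ℕ) :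
    ladderTerm (Ladder.rung.{w} N 0) (Ladder.rung N 1) k = Ladder.rung N k := by
  induction k using Nat.strong_induction_on with
  | _ k ih =>
    match k with
    | 0 => rfl
    | 1 => rfl
    | 2 =>
      change Ladder.rung N 1 ⇨ Ladder.rung N 0 = _
      refine Ladder.mem_rung_himp (m := 0) (fun b => ?_) rfl
      simp only [Ladder.mem_rung]
      omega
    | 3 =>
      change ladderTerm _ _ 2 ⇨ Ladder.rung N 0 = _
      rw [ih 2 (by omega)]
      refine Ladder.mem_rung_himp (m := 1) (fun b => ?_) rfl
      simp only [Ladder.mem_rung]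
      omega
    | k + 4 =>
      change ladderTerm _ _ (k + 3) ⇨ (ladderTerm _ _ (k + 1) ⊔ ladderTerm _ _ k) = _
      rw [ih (k + 3) (by omega), ih (k + 1) (by omega), ih k (by omega)]
      refine Ladder.mem_rung_himp (m := k + 2) (fun b => ?_) rfl
      simp only [LowerSet.mem_sup_iff, Ladder.mem_rung]
      omega

/-- The universe of the three-element chain. -/
inductive Three : Type
  | bot
  | mid
  | top

instance : Finite Three :=
  Finite.of_surjective (fun i : Fin 3 => (![Three.bot, Three.mid, Three.top] i : Three)) fun
    | .bot => ⟨0, rfl⟩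
    | .mid => ⟨1, rfl⟩
    | .top => ⟨2, rfl⟩

/-- The meet of the three-element chain. -/
def Three.inf : Three → Three → Three
  | .bot, _ => .bot
  | .top, y => y
  | .mid, .bot => .bot
  | .mid, _ => .mid

/-- The join of the three-element chain. -/
def Three.sup : Three → Three → Three
  | .bot, y => y
  | .top, _ => .top
  | .mid, .top => .top
  | .mid, _ => .mid

/-- The implication of the three-element chain. -/
def Three.imp : Three → Three → Three
  | .bot, _ => .top
  | .top, y => y
  | .mid, .bot => .bot
  | .mid, _ => .top

instance : heytingLanguage.Structure Three where
  funMap {_} f :=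
    match f with
    | .bot => fun _ => .bot
    | .top => fun _ => .top
    | .inf => fun x => (x 0).inf (x 1)
    | .sup => fun x => (x 0).sup (x 1)
    | .imp => fun x => (x 0).imp (x 1)
  RelMap {_} r := r.elim

/-- A dense element different from `⊤` generates a three-element chain. -/
def threeEmbedding {H : Type w} [HeytingAlgebra H] (d : H) (hbot : d ≠ ⊥) (htop : d ≠ ⊤)
    (hd : d ⇨ ⊥ = ⊥) : Three ↪[heytingLanguage] H where
  toFun
    | .bot => ⊥
    | .mid => d
    | .top => ⊤
  inj' x y := by
    have : (⊥ : H) ≠ ⊤ := fun h => hbot (eq_bot_iff.2 (h ▸ le_top))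
    cases x <;> cases y <;> simp [hbot, htop, hbot.symm, htop.symm, this, this.symm]
  map_fun' {n} f x := by
    cases f with
    | bot => rfl
    | top => rfl
    | inf =>
      change _ = _ ⊓ _
      simp only [Structure.funMap, Function.comp]
      cases x 0 <;> cases x 1 <;> simp [Three.inf]
    | sup =>
      change _ = _ ⊔ _
      simp only [Structure.funMap, Function.comp]
      cases x 0 <;> cases x 1 <;> simp [Three.sup]
    | imp =>
      change _ = _ ⇨ _
      simp only [Structure.funMap, Function.comp]
      cases x 0 <;> cases x 1 <;> simp [Three.imp, hd, -himp_bot]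
  map_rel' r := r.elim

theorem isUltrahomogeneous_exists_aut {L : FirstOrder.Language.{u, v}} {M : Type w} [L.Structure M]
    (hM : L.IsUltrahomogeneous M) {C : Type w'} [L.Structure C] (hC : Structure.FG L C)
    (f f' : C ↪[L] M) : ∃ g : Aut L M, ∀ c, g (f c) = f' c := by
  obtain ⟨g, hg⟩ := hM f.toHom.range (hC.range f.toHom) (f'.comp f.equivRange.symm.toEmbedding)
  refine ⟨g, fun c => ?_⟩
  have := DFunLike.congr_fun hg ⟨f c, Hom.mem_range.2 ⟨c, rfl⟩⟩
  refine this.symm.trans ?_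
  change f' (f.equivRange.symm _) = _
  congr 1
  exact f.equivRange.symm_apply_apply c

theorem isOpen_fixing {L : FirstOrder.Language.{u, v}} {M : Type w} [L.Structure M] {S : Set M}
    (hS : S.Finite) : IsOpen (Aut.fixing (L := L) S : Set (Aut L M)) :=
  isOpen_iff_mem_nhds.2 fun _ hg =>
    (Aut.mem_nhds_iff _ _).2 ⟨S, hS, fun _ hh x hx => (hh x hx).trans (hg x hx)⟩

theorem ladder_mem_finiteHeytingAlgebras (N : ℕ) :
    (⟨LowerSet (Ladder.{w} N), heytingStructure _⟩ :
      CategoryTheory.Bundled.{w} heytingLanguage.Structure) ∈ finiteHeytingAlgebras.{w} :=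
  ⟨Finite.of_injective _ SetLike.coe_injective, ⟨_, _, Ladder.rung_ne_bot N 0⟩, inferInstance, rfl⟩

/-- Pairs of rungs in ladders of different lengths have different types. -/
theorem ladder_length_eq {A : Type w'} [heytingLanguage.Structure A] {N N' : ℕ} (hN : 2 ≤ N)
    (hN' : 2 ≤ N') (f : LowerSet (Ladder.{w} N) ↪[heytingLanguage] A)
    (f' : LowerSet (Ladder.{w} N') ↪[heytingLanguage] A)
    (h₀ : f (Ladder.rung N 0) = f' (Ladder.rung N' 0))
    (h₁ : f (Ladder.rung N 1) = f' (Ladder.rung N' 1)) : N = N' := by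
  have htop : f ⊤ = f' ⊤ := by
    have h (n : ℕ) (e : LowerSet (Ladder.{w} n) ↪[heytingLanguage] A) :
        e ⊤ = Structure.funMap (L := heytingLanguage) HeytingFunc.top default :=
      (e.map_fun (n := 0) HeytingFunc.top default).trans
        (congrArg _ (Subsingleton.elim _ _))
    rw [h, h]
  have hk (k : ℕ) : f (Ladder.rung N k) = f' (Ladder.rung N' k) := by
    rw [← ladderTerm_rung, map_ladderTerm, ← ladderTerm_rung N', map_ladderTerm, h₀, h₁]
  have hiff (k : ℕ) : N + 2 ≤ k ↔ N' + 2 ≤ k := by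
    rw [← Ladder.rung_eq_top_iff.{w} hN, ← Ladder.rung_eq_top_iff.{w} hN', ← f.injective.eq_iff,
      ← f'.injective.eq_iff, hk, htop]
  have := hiff (N + 2)
  have := hiff (N' + 2)
  omega

theorem not_isRoelckePrecompact_aut (L : Type w) [heytingLanguage.Structure L] [Countable L]
    (hL : IsFraisseLimit finiteHeytingAlgebras.{w} L) :
    ¬ IsRoelckePrecompact (Aut heytingLanguage L) := by
  intro hRP
  have hemb (N : ℕ) : Nonempty (LowerSet (Ladder.{w} N) ↪[heytingLanguage] L) :=
    (hL.age.symm ▸ ladder_mem_finiteHeytingAlgebras.{w} N :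
      _ ∈ heytingLanguage.age L).2
  -- The shift by 2 meets the bound needed for `Ladder.rung_eq_top_iff`.
  let e (N : ℕ) := (hemb (N + 2)).some
  have hFG : Structure.FG heytingLanguage Three := Structure.FG.of_finite
  have hne (N k : ℕ) (hk : k ≤ 1) : Ladder.rung.{w} (N + 2) k ≠ ⊤ := fun h => by
    have := (Ladder.rung_eq_top_iff (by omega)).1 h
    omega
  let ι (N k : ℕ) (hk : k ≤ 1) : Three ↪[heytingLanguage] L :=
    (e N).comp (threeEmbedding (Ladder.rung.{w} (N + 2) k) (Ladder.rung_ne_bot _ _) (hne N k hk)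
      (Ladder.himp_bot_eq_bot (Ladder.rung_ne_bot _ _)))
  let c : L := ι 0 0 zero_le_one .mid
  have hmove (N k : ℕ) (hk : k ≤ 1) : ∃ g : Aut heytingLanguage L,
      g c = e N (Ladder.rung (N + 2) k) :=
    (isUltrahomogeneous_exists_aut hL.ultrahomogeneous hFG (ι 0 0 zero_le_one) (ι N k hk)).imp
      fun _ hg => hg .mid
  choose g hg using fun N => hmove N 0 zero_le_one
  choose g' hg' using fun N => hmove N 1 le_rfl
  let V : Subgroup (Aut heytingLanguage L) := Aut.fixing {c}
  have hinj : Function.Injective fun N =>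
      DoubleCoset.doubleCoset ((g N)⁻¹ * g' N) (V : Set (Aut heytingLanguage L)) V := by
    intro N N' h
    have hmem := DoubleCoset.mem_doubleCoset_self V V ((g N)⁻¹ * g' N)
    rw [show DoubleCoset.doubleCoset ((g N)⁻¹ * g' N) (V : Set (Aut heytingLanguage L)) V = _
      from h, DoubleCoset.mem_doubleCoset] at hmem
    obtain ⟨x, hx, y, hy, hxy⟩ := hmem
    replace hx : x c = c := hx c rfl
    replace hy : y c = c := hy c rfl
    -- Equal double cosets make this automorphism carry the pair of rungs for `N'` to the pair for
    -- `N`.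
    let σ : Aut heytingLanguage L := g N * x * (g N')⁻¹
    have h₀ : σ (g N' c) = g N c := by
      change g N (x ((g N')⁻¹ (g N' c))) = _
      rw [Aut.inv_apply_self, hx]
    have h₁ : σ (g' N' c) = g' N c := by
      have h₂ : g' N = σ * g' N' * y := by
        rw [← mul_inv_cancel_left (g N) (g' N), hxy]
        simp only [σ, mul_assoc]
      conv_rhs => rw [h₂, Aut.mul_apply, Aut.mul_apply, hy]
    rw [hg, hg] at h₀
    rw [hg', hg'] at h₁
    have := ladder_length_eq (by omega) (by omega) (σ.toEmbedding.comp (e N')) (e N) h₀ h₁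
    omega
  exact Set.infinite_range_of_injective hinj
    ((hRP V (isOpen_fixing (Set.finite_singleton c))).subset (by
      rintro _ ⟨N, rfl⟩
      exact ⟨_, rfl⟩))

end Structures

end HeytingAut

theorem mainTheorem3 (L : Type w) [HeytingAut.heytingLanguage.Structure L] [Countable L]
    (hL : FirstOrder.Language.IsFraisseLimit HeytingAut.finiteHeytingAlgebras.{w} L) :
    ¬ HeytingAut.IsRoelckePrecompact (HeytingAut.Aut HeytingAut.heytingLanguage L) ∧
      ∀ (L' : FirstOrder.Language.{u, v}) (M : Type w') [L'.Structure M],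
        HeytingAut.IsCountableOmegaCategorical L' M →
          IsEmpty (HeytingAut.Aut HeytingAut.heytingLanguage L ≃ₜ* HeytingAut.Aut L' M) :=
  ⟨HeytingAut.not_isRoelckePrecompact_aut L hL, fun _ _ _ hM =>
    ⟨fun e => HeytingAut.not_isRoelckePrecompact_aut L hL
      (HeytingAut.IsRoelckePrecompact.of_continuousMulEquiv e hM.isRoelckePrecompact)⟩⟩
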